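/- \textbf{Setting.} A \emph{composite B\'ezier curve} is a curve $\mathcal{B}:[0,1]\to\mathbb{R}^3$ for which there are $m\ge 1$, parameters $0=\tau_0<\tau_1<\dots<\tau_m=1$, degrees $n_j$ and control points $p_{j,0},\dots,p_{j,n_j}\in\mathbb{R}^3$ ($0\le j<m$) with $p_{j,n_j}=p_{j+1,0}$ for $j+1<m$, such that $$\mathcal{B}\bigl(\tau_j+u(\tau_{j+1}-\tau_j)\bigr)=\sum_{l=0}^{n_j}\binom{n_j}{l}u^l(1-u)^{n_j-l}\,p_{j,l}\qquad(u\in[0,1],\ 0\le j<m).$$ Its \emph{control polygon} is the PL curve $\mathcal{P}:[0,1]\to\mathbb{R}^3$ that on each $[\tau_j,\tau_{j+1}]$ is the uniformly parametrized polygon with vertices $p_{j,0},\dots,p_{j,n_j}$. One \emph{subdivision} replaces every polygon $p=(p_0,\dots,p_n)$ by the two polygons $(p_0^{0},p_0^{1},\dots,p_0^{n})$ and $(p_0^{n},p_1^{n-1},\dots,p_n^{0})$, where $p_l^{0}=p_l$ and $p_l^{r+1}=\frac12(p_l^{r}+p_{l+1}^{r})$ (the de Casteljau algorithm with value $\frac12$),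 and halves every parameter interval. A curve $\gamma:[0,1]\to\mathbb{R}^3$ is \emph{simple} if $\gamma(s)=\gamma(t)$ with $s<t$ holds at most for $s=0$, $t=1$ (so simple closed curves are allowed), and \emph{regular} if it is differentiable and $\gamma'$ never vanishes. \textbf{Theorem.} Let $\mathcal{B}$ be a simple, regular, $C^1$ composite B\'ezier curve in $\mathbb{R}^3$. If $\mathcal{B}$ is closed, assume in addition that it has no cusp at its closing point, i.e.\ that $\mathcal{B}'(0)$ is not a negative multiple of $\mathcal{B}'(1)$; this holds in particular if $\mathcal{B}$ is $C^1$ as a closed curve, $\mathcal{B}'(0)=\mathcal{B}'(1)$. Then there is an $N$ such that for every $i\ge N$ the control polygon obtained after $i$ subdivisions is simple and its image is homeomorphic to the image of $\mathcal{B}$. -/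

import Mathlib

noncomputable section

/-- Euclidean three-space. -/
abbrev R3 : Type := EuclideanSpace ℝ (Fin 3)

/-- The point with parameter `t` on the Bézier curve of degree `n` with control points
`p 0, …, p n` (the values `p j` with `j > n` play no role). -/
def bezier (n : ℕ) (p : ℕ → R3) (t : ℝ) : R3 :=
  ∑ j ∈ Finset.range (n + 1), ((n.choose j : ℝ) * t ^ j * (1 - t) ^ (n - j)) • p j

/-- The uniform parametrization over `[0, 1]` of the PL curve with vertices `p 0, …, p n`: the
vertex `p j` is taken at `t = j / n`, and the map is affine in between. -/
def polygonal (n : ℕ) (p : ℕ → R3) (t : ℝ) : R3 :=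
  AffineMap.lineMap (p ⌊(n : ℝ) * t⌋₊) (p (⌊(n : ℝ) * t⌋₊ + 1)) ((n : ℝ) * t - ⌊(n : ℝ) * t⌋₊)

/-- The de Casteljau scheme with value `1/2`: `deCasteljau p r` is the list of points after `r`
rounds of replacing a polygon by the midpoints of its edges. -/
def deCasteljau (p : ℕ → R3) : ℕ → ℕ → R3
  | 0, j => p j
  | r + 1, j => midpoint ℝ (deCasteljau p r j) (deCasteljau p r (j + 1))

/-- The first of the two control polygons (of degree `n`) that one subdivision generates. -/
def leftPolygon (p : ℕ → R3) (j : ℕ) : R3 := deCasteljau p j 0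

/-- The second of the two control polygons (of degree `n`) that one subdivision generates. -/
def rightPolygon (n : ℕ) (p : ℕ → R3) (j : ℕ) : R3 := deCasteljau p (n - j) j

/-- The data of a composite Bézier curve parametrized over `[0, 1]`: finitely many Bézier segments
(of possibly different degrees), joined at common end points; segment number `j < numSeg` is run
through for parameters between `knot j` and `knot (j + 1)`, where
`0 = knot 0 < knot 1 < ⋯ < knot numSeg = 1`. -/
structure CompositeBezier where
  numSeg : ℕ
  deg : ℕ → ℕ
  ctrl : ℕ → ℕ → R3
  knot : ℕ → ℝ
  numSeg_pos : 0 < numSeg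
  knot_zero : knot 0 = 0
  knot_last : knot numSeg = 1
  knot_lt : ∀ j < numSeg, knot j < knot (j + 1)
  joined : ∀ j, j + 1 < numSeg → ctrl j (deg j) = ctrl (j + 1) 0

namespace CompositeBezier

open Classical in
/-- The number of the segment to which the parameter `t ∈ [0, 1]` belongs: the largest
`j < numSeg` with `knot j ≤ t`. -/
def index (C : CompositeBezier) (t : ℝ) : ℕ :=
  Nat.findGreatest (fun j => C.knot j ≤ t) (C.numSeg - 1)

/-- The parameter in `[0, 1]` that `t` has within its segment. -/
def localParam (C : CompositeBezier) (t : ℝ) : ℝ :=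
  (t - C.knot (C.index t)) / (C.knot (C.index t + 1) - C.knot (C.index t))

/-- The composite Bézier curve, as a parametrized curve over `[0, 1]`. -/
def curve (C : CompositeBezier) (t : ℝ) : R3 :=
  bezier (C.deg (C.index t)) (C.ctrl (C.index t)) (C.localParam t)

/-- The control polygon (the union of the control polygons of the segments), as a parametrized PL
curve over `[0, 1]`. -/
def controlPolygon (C : CompositeBezier) (t : ℝ) : R3 :=
  polygonal (C.deg (C.index t)) (C.ctrl (C.index t)) (C.localParam t)

/-- One subdivision (at the parameter `1/2` of each segment): segment `j` is replaced by the
segments `2 * j` and `2 * j + 1`. -/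
def subdivide (C : CompositeBezier) : CompositeBezier where
  numSeg := 2 * C.numSeg
  deg q := C.deg (q / 2)
  ctrl q := if q % 2 = 0 then leftPolygon (C.ctrl (q / 2))
    else rightPolygon (C.deg (q / 2)) (C.ctrl (q / 2))
  knot q := if q % 2 = 0 then C.knot (q / 2) else (C.knot (q / 2) + C.knot (q / 2 + 1)) / 2
  numSeg_pos := by have := C.numSeg_pos; omega
  knot_zero := by simpa using C.knot_zero
  knot_last := by simpa using C.knot_last
  knot_lt := by
    intro q hq
    have h := C.knot_lt (q / 2) (by omega)
    rcases Nat.mod_two_eq_zero_or_one q with h0 | h1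
    · have e1 : (q + 1) % 2 = 1 := by omega
      have e2 : (q + 1) / 2 = q / 2 := by omega
      simp only [h0, e1, e2, if_true, one_ne_zero, if_false]
      linarith
    · have e1 : (q + 1) % 2 = 0 := by omega
      have e2 : (q + 1) / 2 = q / 2 + 1 := by omega
      simp only [h1, e1, e2, if_true, one_ne_zero, if_false]
      linarith
  joined := by
    intro q hq
    rcases Nat.mod_two_eq_zero_or_one q with h0 | h1
    · have e1 : (q + 1) % 2 = 1 := by omega
      have e2 : (q + 1) / 2 = q / 2 := by omega
      simp [h0, e1, e2, leftPolygon, rightPolygon]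
    · have e1 : (q + 1) % 2 = 0 := by omega
      have e2 : (q + 1) / 2 = q / 2 + 1 := by omega
      have h := C.joined (q / 2) (by omega)
      simpa [h1, e1, e2, leftPolygon, rightPolygon, deCasteljau] using h

end CompositeBezier

/-- A curve parametrized over `[0, 1]` is simple (non-self-intersecting) if no point is taken at
two different parameters, except that the curve may be closed, its two ends being the same point. -/
def IsSimpleCurve (γ : ℝ → R3) : Prop :=
  ∀ s ∈ Set.Icc (0 : ℝ) 1, ∀ t ∈ Set.Icc (0 : ℝ) 1, s < t → γ s = γ t → s = 0 ∧ t = 1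

/-- A curve parametrized over `[0, 1]` is regular if it is differentiable and its first derivative
(one-sided at the ends) never vanishes. -/
def IsRegularCurve (γ : ℝ → R3) : Prop :=
  DifferentiableOn ℝ γ (Set.Icc 0 1) ∧
    ∀ t ∈ Set.Icc (0 : ℝ) 1, derivWithin γ (Set.Icc 0 1) t ≠ 0

/-- A curve parametrized over `[0, 1]` has a closing cusp if it is closed and turns back at the
common end point: the initial and final tangent vectors are opposite in direction. A closed regular
curve that is `C¹` also at the closing point, `γ' 0 = γ' 1`, has no closing cusp. -/
def HasClosingCusp (γ : ℝ → R3) : Prop :=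
  γ 0 = γ 1 ∧ ∃ c : ℝ, 0 < c ∧
    derivWithin γ (Set.Icc 0 1) 0 = -(c • derivWithin γ (Set.Icc 0 1) 1)

end

/-! The control polygon is a perturbation of the curve, fixed at both ends, whose Lipschitz constant
tends to 0 under subdivision. One subdivision divides second differences of control points by 4 but
parameter intervals only by 2. Since the derivatives of polygon and curve differ by at most a
multiple of the second differences over the interval length, the Lipschitz constant after `i`
subdivisions is at most `K / 2 ^ i` (`SecondDiffBound.iterate`, `SecondDiffBound.norm_le`).

On the other side, compactness gives chords of the curve a lower bound `c` times the parameter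
distance, taken around the circle if the curve is closed (`exists_chordBound`). Once `K / 2 ^ i <
c`, the perturbation cannot close up a chord (`eq_of_chordBound`). Polygon and curve then have the
same double points, so both images are the same quotient of the interval
(`nonempty_homeomorph_image`). -/

/-! ### Bézier curves as powers of operators on sequences -/

/-- The shift operator on sequences of points. -/
def shiftEnd : Module.End ℝ (ℕ → R3) := LinearMap.funLeft ℝ R3 Nat.succ

theorem shiftEnd_pow_apply (k : ℕ) (p : ℕ → R3) (j : ℕ) : (shiftEnd ^ k) p j = p (j + k) := by
  induction k generalizing j with
  | zero => simp
  | succ k ih =>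
    rw [pow_succ']
    change (shiftEnd ^ k) p (j + 1) = _
    rw [ih]; congr 1; omega

/-- The binomial theorem. It turns reparametrization of a Bézier curve into rewriting the base of a
power. -/
theorem Commute.add_smul_pow_apply {A B : Module.End ℝ (ℕ → R3)} (h : Commute A B) (a b : ℝ)
    (n : ℕ) (p : ℕ → R3) :
    ((a • A + b • B) ^ n) p 0 = ∑ j ∈ Finset.range (n + 1),
      ((n.choose j : ℝ) * a ^ j * b ^ (n - j)) • (A ^ j) ((B ^ (n - j)) p) 0 := by
  rw [((h.smul_left a).smul_right b).add_pow, LinearMap.sum_apply, Finset.sum_apply]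
  refine Finset.sum_congr rfl fun j _ => ?_
  rw [smul_pow, smul_pow, smul_mul_smul_comm, ← nsmul_eq_mul', ← Nat.cast_smul_eq_nsmul ℝ,
    smul_smul, mul_assoc]
  rfl

theorem bezier_eq_pow (n : ℕ) (p : ℕ → R3) (t : ℝ) :
    bezier n p t = (((t • shiftEnd + (1 - t) • 1 : Module.End ℝ (ℕ → R3)) ^ n) p) 0 := by
  rw [(Commute.one_right shiftEnd).add_smul_pow_apply, bezier]
  simp [shiftEnd_pow_apply]

theorem deCasteljau_eq_pow (p : ℕ → R3) (r j : ℕ) :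
    deCasteljau p r j =
      ((((1 / 2 : ℝ) • (shiftEnd + 1) : Module.End ℝ (ℕ → R3)) ^ r) p) j := by
  induction r generalizing j with
  | zero => simp [deCasteljau]
  | succ r ih =>
    rw [pow_succ', deCasteljau, ih, ih, midpoint_eq_smul_add]
    simp [shiftEnd, LinearMap.funLeft, add_comm]

/-- With E the shift and A = (E + 1)/2, the new control points are A^j p at 0, and (u/2)E + (1 -
u/2) = uA + (1 - u). -/
theorem bezier_leftPolygon (n : ℕ) (p : ℕ → R3) (u : ℝ) :
    bezier n (leftPolygon p) u = bezier n p (u / 2) := by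
  set A : Module.End ℝ (ℕ → R3) := (1 / 2 : ℝ) • (shiftEnd + 1) with hA
  have hs : ((u / 2) • shiftEnd + (1 - u / 2) • 1 : Module.End ℝ (ℕ → R3)) =
      u • A + (1 - u) • 1 := by
    rw [hA]; module
  rw [bezier_eq_pow n p, hs, (Commute.one_right A).add_smul_pow_apply, bezier]
  simp only [leftPolygon, deCasteljau_eq_pow, one_pow, Module.End.one_apply, hA]

/-- Here the control points are E^j A^(n-j) p at 0, and the base of the power is uE + (1 - u)A. -/
theorem bezier_rightPolygon (n : ℕ) (p : ℕ → R3) (u : ℝ) :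
    bezier n (rightPolygon n p) u = bezier n p ((1 + u) / 2) := by
  set A : Module.End ℝ (ℕ → R3) := (1 / 2 : ℝ) • (shiftEnd + 1) with hA
  have hcA : Commute shiftEnd A :=
    ((Commute.refl shiftEnd).add_right (Commute.one_right _)).smul_right _
  have hs : (((1 + u) / 2) • shiftEnd + (1 - (1 + u) / 2) • 1 : Module.End ℝ (ℕ → R3)) =
      u • shiftEnd + (1 - u) • A := by
    rw [hA]; module
  rw [bezier_eq_pow n p, hs, hcA.add_smul_pow_apply, bezier]
  simp only [rightPolygon, deCasteljau_eq_pow, shiftEnd_pow_apply, zero_add, hA]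

theorem bezier_zero (n : ℕ) (p : ℕ → R3) : bezier n p 0 = p 0 := by
  simp [bezier_eq_pow]

theorem bezier_one (n : ℕ) (p : ℕ → R3) : bezier n p 1 = p n := by
  simp [bezier_eq_pow, shiftEnd_pow_apply]

theorem bezier_succ (n : ℕ) (p : ℕ → R3) (t : ℝ) :
    bezier (n + 1) p t = (1 - t) • bezier n p t + t • bezier n (fun j => p (j + 1)) t := by
  have h : (fun j => p (j + 1)) = shiftEnd p := rfl
  rw [h, bezier_eq_pow, bezier_eq_pow, bezier_eq_pow, pow_succ, Module.End.mul_apply]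
  simp [add_comm]

theorem bezier_sub (n : ℕ) (p q : ℕ → R3) (t : ℝ) :
    bezier n (p - q) t = bezier n p t - bezier n q t := by
  simp [bezier_eq_pow]

theorem bezier_hasDerivAt (n : ℕ) (p : ℕ → R3) (t : ℝ) :
    HasDerivAt (bezier n p) ((n : ℝ) • bezier (n - 1) (fun j => p (j + 1) - p j) t) t := by
  induction n generalizing p with
  | zero =>
    have : bezier 0 p = fun _ => p 0 := by ext1 t; simp [bezier]
    rw [this]; simpa using hasDerivAt_const t (p 0)
  | succ n ih =>
    have h1 : HasDerivAt (fun t : ℝ => 1 - t) (-1) t := by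
      simpa using (hasDerivAt_id t).const_sub 1
    have h := (h1.smul (ih p)).add ((hasDerivAt_id t).smul (ih fun j => p (j + 1)))
    have e : bezier (n + 1) p = ((fun t : ℝ => 1 - t) • bezier n p) +
        ((id : ℝ → ℝ) • bezier n fun j => p (j + 1)) := by
      ext1 t; rw [bezier_succ]; rfl
    rw [e]
    refine h.congr_deriv ?_
    have e2 := bezier_sub n (fun j => p (j + 1)) p t
    have e3 : ((fun j => p (j + 1)) - p) = fun j => p (j + 1) - p j := rfl
    rw [e3] at e2
    rw [Nat.add_sub_cancel]
    rcases n with _ | m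
    · rw [e2]; simp; module
    · have e4 := bezier_succ m (fun j => p (j + 1) - p j) t
      rw [Nat.add_sub_cancel, id]
      push_cast
      have : ∀ a b c d e : R3, c = b - a → c = (1 - t) • d + t • e →
        (1 - t) • ((m : ℝ) + 1) • d + (-1 : ℝ) • a + (t • ((m : ℝ) + 1) • e + (1 : ℝ) • b) =
          ((m : ℝ) + 1 + 1) • c := by
        intro a b c d e h1 h2
        -- One copy of `c` is expanded as a difference of curves, the other `m + 1` by the de
        -- Casteljau recursion.
        have : ((m : ℝ) + 1 + 1) • c = ((m : ℝ) + 1) • c + c := by module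
        rw [this]; nth_rw 2 [h1]; rw [h2]; module
      exact this _ _ _ _ _ e2 e4

/-- The convex hull property, for balls. -/
theorem norm_bezier_sub_le {n : ℕ} {p : ℕ → R3} {v : R3} {M t : ℝ} (ht : t ∈ Set.Icc (0 : ℝ) 1)
    (h : ∀ j ≤ n, ‖p j - v‖ ≤ M) : ‖bezier n p t - v‖ ≤ M := by
  induction n generalizing p with
  | zero => simpa [bezier] using h 0 le_rfl
  | succ n ih =>
    have h1 := ih (p := p) fun j hj => h j (by omega)
    have h2 := ih (p := fun j => p (j + 1)) fun j hj => h (j + 1) (by omega)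
    rw [bezier_succ]
    have e : (1 - t) • bezier n p t + t • bezier n (fun j => p (j + 1)) t - v =
        (1 - t) • (bezier n p t - v) + t • (bezier n (fun j => p (j + 1)) t - v) := by module
    rw [e]
    calc _ ≤ (1 - t) * M + t * M := by
          refine (norm_add_le _ _).trans (add_le_add ?_ ?_)
          · rw [norm_smul, Real.norm_of_nonneg (by linarith [ht.2])]
            exact mul_le_mul_of_nonneg_left h1 (by linarith [ht.2])
          · rw [norm_smul, Real.norm_of_nonneg ht.1]
            exact mul_le_mul_of_nonneg_left h2 ht.1
      _ = M := by ring

/-! ### Second differences under subdivision -/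

/-- The second difference of a sequence of points. -/
def secondDiff (p : ℕ → R3) (j : ℕ) : R3 := p (j + 2) - (2 : ℝ) • p (j + 1) + p j

/-- Second differencing commutes with taking midpoints, so each round only averages second
differences. -/
theorem norm_secondDiff_deCasteljau_le {n : ℕ} {p : ℕ → R3} {M : ℝ}
    (h : ∀ j, j + 2 ≤ n → ‖secondDiff p j‖ ≤ M) (r j : ℕ) (hj : r + j + 2 ≤ n) :
    ‖secondDiff (deCasteljau p r) j‖ ≤ M := by
  induction r generalizing j with
  | zero => exact h j (by omega)
  | succ r ih =>
    have e : secondDiff (deCasteljau p (r + 1)) j = (1 / 2 : ℝ) •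
        (secondDiff (deCasteljau p r) j + secondDiff (deCasteljau p r) (j + 1)) := by
      simp only [secondDiff, deCasteljau, midpoint_eq_smul_add, invOf_eq_inv]
      rw [show j + 1 + 2 = j + 2 + 1 by ring]
      module
    rw [e, norm_smul]
    have := norm_add_le (secondDiff (deCasteljau p r) j) (secondDiff (deCasteljau p r) (j + 1))
    have h1 := ih j (by omega)
    have h2 := ih (j + 1) (by omega)
    norm_num
    linarith

/-- A - 1 = (E - 1)/2, and squaring gives the factor 1/4. For the right polygon the same holds with
E - A = (E - 1)/2. -/
theorem secondDiff_leftPolygon (p : ℕ → R3) (j : ℕ) :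
    secondDiff (leftPolygon p) j = (1 / 4 : ℝ) • secondDiff (deCasteljau p j) 0 := by
  simp only [secondDiff, leftPolygon, deCasteljau, midpoint_eq_smul_add, invOf_eq_inv]
  module

theorem secondDiff_rightPolygon {n : ℕ} (p : ℕ → R3) {j : ℕ} (hj : j + 2 ≤ n) :
    secondDiff (rightPolygon n p) j =
      (1 / 4 : ℝ) • secondDiff (deCasteljau p (n - j - 2)) j := by
  obtain ⟨r, rfl⟩ := Nat.exists_eq_add_of_le hj
  have e1 : j + 2 + r - (j + 2) = r := by omega
  have e2 : j + 2 + r - (j + 1) = r + 1 := by omega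
  have e3 : j + 2 + r - j = r + 1 + 1 := by omega
  have e4 : r + 1 + 1 - 2 = r := by omega
  simp only [secondDiff, rightPolygon, e1, e2, e3, e4, deCasteljau, midpoint_eq_smul_add,
    invOf_eq_inv, show j + 1 + 1 = j + 2 from rfl]
  module

theorem norm_diff_sub_diff_le {n : ℕ} {p : ℕ → R3} {M : ℝ} (hM : 0 ≤ M)
    (h : ∀ j, j + 2 ≤ n → ‖secondDiff p j‖ ≤ M) {i j : ℕ} (hi : i < n) (hj : j < n) :
    ‖(p (i + 1) - p i) - (p (j + 1) - p j)‖ ≤ n * M := by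
  have key : ∀ k i, i + k < n →
      ‖(p (i + k + 1) - p (i + k)) - (p (i + 1) - p i)‖ ≤ k * M := by
    intro k i
    induction k with
    | zero => simp
    | succ k ih =>
      intro hk
      have h1 := ih (by omega)
      have h2 := h (i + k) (by omega)
      have e : (p (i + (k + 1) + 1) - p (i + (k + 1))) - (p (i + 1) - p i) =
          secondDiff p (i + k) + ((p (i + k + 1) - p (i + k)) - (p (i + 1) - p i)) := by
        simp only [secondDiff, ← add_assoc]; module
      rw [e]
      push_cast
      linarith [norm_add_le (secondDiff p (i + k))
        ((p (i + k + 1) - p (i + k)) - (p (i + 1) - p i))]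
  rcases le_total j i with hle | hle
  · obtain ⟨k, rfl⟩ := Nat.exists_eq_add_of_le hle
    refine (key k j hi).trans (mul_le_mul_of_nonneg_right ?_ hM)
    exact_mod_cast (by omega : k ≤ n)
  · obtain ⟨k, rfl⟩ := Nat.exists_eq_add_of_le hle
    rw [norm_sub_rev]
    refine (key k i hj).trans (mul_le_mul_of_nonneg_right ?_ hM)
    exact_mod_cast (by omega : k ≤ n)

/-! ### Polygon against curve on one segment -/

/-- A function that satisfies a Lipschitz estimate on each interval of a partition satisfies it on
the whole interval. -/
theorem lipschitz_of_partition {f : ℝ → R3} {K : ℝ} {x : ℕ → ℝ} {m : ℕ}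
    (h : ∀ j < m, ∀ s t, x j ≤ s → s ≤ t → t ≤ x (j + 1) → ‖f t - f s‖ ≤ K * (t - s)) :
    (∀ j < m, x j ≤ x (j + 1)) →
      ∀ s t, x 0 ≤ s → s ≤ t → t ≤ x m → s < t → ‖f t - f s‖ ≤ K * (t - s) := by
  induction m with
  | zero => intro _ s t h0 h1 h2 h3; linarith
  | succ m ih =>
    intro hx s t h0 h1 h2 h3
    have ih' := ih (fun j hj => h j (by omega)) (fun j hj => hx j (by omega))
    rcases le_or_gt t (x m) with ht | ht
    · exact ih' s t h0 h1 ht h3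
    · rcases le_or_gt (x m) s with hs | hs
      · exact h m (by omega) s t hs h1 h2
      · have e1 := ih' s (x m) h0 hs.le le_rfl hs
        have e2 := h m (by omega) (x m) t le_rfl ht.le h2
        have e3 : f t - f s = (f t - f (x m)) + (f (x m) - f s) := by abel
        rw [e3]
        linarith [norm_add_le (f t - f (x m)) (f (x m) - f s)]

/-- At the right end the floor jumps to `j + 1`, but both formulas give the vertex `p (j + 1)`. -/
theorem polygonal_eq_lineMap {n j : ℕ} (p : ℕ → R3) {t : ℝ} (h0 : (j : ℝ) ≤ n * t)
    (h1 : n * t ≤ j + 1) :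
    polygonal n p t = AffineMap.lineMap (p j) (p (j + 1)) (n * t - j) := by
  rcases h1.eq_or_lt with h | h
  · have hf : ⌊(n : ℝ) * t⌋₊ = j + 1 := by
      rw [h]; exact_mod_cast Nat.floor_natCast (R := ℝ) (j + 1)
    rw [polygonal, hf, h]; simp
  · have hf : ⌊(n : ℝ) * t⌋₊ = j := by
      rw [Nat.floor_eq_iff (by have : (0 : ℝ) ≤ j := Nat.cast_nonneg j
                               linarith)]
      exact ⟨h0, h⟩
    rw [polygonal, hf]

theorem polygonal_zero (n : ℕ) (p : ℕ → R3) : polygonal n p 0 = p 0 := by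
  simp [polygonal]

theorem polygonal_one (n : ℕ) (p : ℕ → R3) : polygonal n p 1 = p n := by
  simp [polygonal]

/-- The derivatives are `n` times an edge vector and `n` times a Bézier curve in the edge vectors.
Edge vectors differ by at most `n * M`, so the mean value inequality applies edge by edge. -/
theorem norm_polygonal_sub_bezier_le {n : ℕ} {p : ℕ → R3} {M : ℝ} (hM : 0 ≤ M)
    (h : ∀ j, j + 2 ≤ n → ‖secondDiff p j‖ ≤ M) {s t : ℝ} (hs : 0 ≤ s) (hst : s < t)
    (ht : t ≤ 1) :
    ‖(polygonal n p t - bezier n p t) - (polygonal n p s - bezier n p s)‖ ≤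
      (n : ℝ) ^ 2 * M * (t - s) := by
  rcases Nat.eq_zero_or_pos n with rfl | hn
  · simp [polygonal, bezier]
  have hn' : (0 : ℝ) < n := by exact_mod_cast hn
  refine lipschitz_of_partition (f := fun t => polygonal n p t - bezier n p t)
    (x := fun j => (j : ℝ) / n) (m := n) ?_ ?_ s t (by simpa using hs) hst.le
    (by rw [div_self hn'.ne']; exact ht) hst
  · intro j hj s t hs hst ht
    rw [div_le_iff₀' hn'] at hs
    rw [le_div_iff₀' hn'] at ht
    push_cast at ht
    have hnst : (n : ℝ) * s ≤ n * t := mul_le_mul_of_nonneg_left hst hn'.le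
    have e1 := polygonal_eq_lineMap p hs (hnst.trans ht)
    have e2 := polygonal_eq_lineMap p (hs.trans hnst) ht
    have hj0 : (0 : ℝ) ≤ j := Nat.cast_nonneg j
    have hjn : (j : ℝ) + 1 ≤ n := by exact_mod_cast hj
    have hs0 : 0 ≤ s := by
      by_contra hc
      have := mul_neg_of_pos_of_neg hn' (not_le.1 hc)
      linarith
    have ht1 : t ≤ 1 := by
      by_contra hc
      have := mul_lt_mul_of_pos_left (not_le.1 hc) hn'
      linarith
    set w : R3 := p (j + 1) - p j with hw
    -- On edge `j` this function differs from polygon minus curve by a constant, and it is smooth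
    -- across the vertices.
    have hd : ∀ u ∈ Set.Icc (0 : ℝ) 1, HasDerivWithinAt
        (fun u : ℝ => u • (n : ℝ) • w - bezier n p u)
        ((n : ℝ) • w - (n : ℝ) • bezier (n - 1) (fun j => p (j + 1) - p j) u)
        (Set.Icc (0 : ℝ) 1) u := by
      intro u _
      have := ((hasDerivAt_id u).smul_const ((n : ℝ) • w)).sub (bezier_hasDerivAt n p u)
      rw [one_smul] at this
      exact this.hasDerivWithinAt
    have hb : ∀ u ∈ Set.Icc (0 : ℝ) 1,
        ‖(n : ℝ) • w - (n : ℝ) • bezier (n - 1) (fun j => p (j + 1) - p j) u‖ ≤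
          (n : ℝ) ^ 2 * M := by
      intro u hu
      rw [← smul_sub, norm_smul, Real.norm_of_nonneg hn'.le, norm_sub_rev, sq, mul_assoc]
      refine mul_le_mul_of_nonneg_left ?_ hn'.le
      exact norm_bezier_sub_le hu fun i hi => norm_diff_sub_diff_le hM h (by omega) hj
    have hmv := (convex_Icc (0 : ℝ) 1).norm_image_sub_le_of_norm_hasDerivWithin_le hd hb
      ⟨hs0, hst.trans ht1⟩ ⟨hs0.trans hst, ht1⟩
    rw [Real.norm_of_nonneg (by linarith)] at hmv
    refine (le_of_eq (congrArg norm ?_)).trans hmv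
    simp only [e1, e2, AffineMap.lineMap_apply_module', ← hw]
    module
  · intro j _
    gcongr
    exact j.le_succ

/-! ### Composite curves and their subdivisions -/

namespace CompositeBezier

theorem knot_mono (C : CompositeBezier) {i j : ℕ} (hij : i ≤ j) (hj : j ≤ C.numSeg) :
    C.knot i ≤ C.knot j := by
  induction j, hij using Nat.le_induction with
  | base => exact le_rfl
  | succ j _ ih => exact (ih (by omega)).trans (C.knot_lt j (by omega)).le

theorem index_eq (C : CompositeBezier) {q : ℕ} (hq : q < C.numSeg) {t : ℝ}
    (h0 : C.knot q ≤ t) (h1 : t < C.knot (q + 1) ∨ q + 1 = C.numSeg) : C.index t = q := by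
  classical
  rw [index, Nat.findGreatest_eq_iff]
  refine ⟨by omega, fun _ => h0, fun k hk hk' hc => ?_⟩
  rcases h1 with h1 | h1
  · have := C.knot_mono (show q + 1 ≤ k by omega) (by omega)
    linarith
  · omega

theorem exists_segment (C : CompositeBezier) {t : ℝ} (ht : t ∈ Set.Icc (0 : ℝ) 1) :
    ∃ q < C.numSeg, C.knot q ≤ t ∧ t ≤ C.knot (q + 1) := by
  classical
  have h1 : ∃ q, t ≤ C.knot (q + 1) ∧ q < C.numSeg := by
    refine ⟨C.numSeg - 1, ?_, by have := C.numSeg_pos; omega⟩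
    rw [Nat.sub_add_cancel C.numSeg_pos, C.knot_last]; exact ht.2
  have h2 := Nat.find_spec h1
  refine ⟨Nat.find h1, h2.2, ?_, h2.1⟩
  rcases Nat.eq_zero_or_pos (Nat.find h1) with h | h
  · rw [h, C.knot_zero]; exact ht.1
  · have h3 := Nat.find_min h1 (show Nat.find h1 - 1 < Nat.find h1 by omega)
    rw [Nat.sub_add_cancel h] at h3
    by_contra hc
    exact h3 ⟨(not_le.1 hc).le, by omega⟩

/-- On the closed parameter interval of a segment, a curve assembled from segments that agree at
the joints is given by that segment. -/
theorem segment_eq (C : CompositeBezier) (F : ℕ → (ℕ → R3) → ℝ → R3)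
    (F0 : ∀ n p, F n p 0 = p 0) (F1 : ∀ n p, F n p 1 = p n) {q : ℕ} (hq : q < C.numSeg) {t : ℝ}
    (h0 : C.knot q ≤ t) (h1 : t ≤ C.knot (q + 1)) :
    F (C.deg (C.index t)) (C.ctrl (C.index t)) (C.localParam t) =
      F (C.deg q) (C.ctrl q) ((t - C.knot q) / (C.knot (q + 1) - C.knot q)) := by
  by_cases hlt : t < C.knot (q + 1) ∨ q + 1 = C.numSeg
  · rw [localParam, C.index_eq hq h0 hlt]
  -- At an interior knot `index` selects the next segment; `joined` reconciles the two values.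
  · push Not at hlt
    have ht : t = C.knot (q + 1) := le_antisymm h1 hlt.1
    have hq1 : q + 1 < C.numSeg := by omega
    rw [localParam, C.index_eq hq1 hlt.1 (Or.inl (ht ▸ C.knot_lt _ hq1)), ht, sub_self, zero_div,
      F0, div_self (sub_pos.2 (C.knot_lt q hq)).ne', F1, C.joined q hq1]

theorem curve_eq (C : CompositeBezier) {q : ℕ} (hq : q < C.numSeg) {t : ℝ}
    (h0 : C.knot q ≤ t) (h1 : t ≤ C.knot (q + 1)) :
    C.curve t = bezier (C.deg q) (C.ctrl q) ((t - C.knot q) / (C.knot (q + 1) - C.knot q)) :=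
  C.segment_eq bezier bezier_zero bezier_one hq h0 h1

theorem controlPolygon_eq (C : CompositeBezier) {q : ℕ} (hq : q < C.numSeg) {t : ℝ}
    (h0 : C.knot q ≤ t) (h1 : t ≤ C.knot (q + 1)) :
    C.controlPolygon t =
      polygonal (C.deg q) (C.ctrl q) ((t - C.knot q) / (C.knot (q + 1) - C.knot q)) :=
  C.segment_eq polygonal polygonal_zero polygonal_one hq h0 h1

theorem controlPolygon_zero (C : CompositeBezier) : C.controlPolygon 0 = C.curve 0 := by
  have h := (C.knot_lt 0 C.numSeg_pos).le
  rw [C.controlPolygon_eq C.numSeg_pos C.knot_zero.le (C.knot_zero ▸ h),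
    C.curve_eq C.numSeg_pos C.knot_zero.le (C.knot_zero ▸ h), C.knot_zero]
  simp [polygonal_zero, bezier_zero]

theorem controlPolygon_one (C : CompositeBezier) : C.controlPolygon 1 = C.curve 1 := by
  obtain ⟨m, hm⟩ : ∃ m, C.numSeg = m + 1 := Nat.exists_eq_succ_of_ne_zero C.numSeg_pos.ne'
  have hl : C.knot (m + 1) = 1 := hm ▸ C.knot_last
  have hlt := C.knot_lt m (by omega)
  rw [C.controlPolygon_eq (q := m) (by omega) (hl ▸ hlt.le) hl.ge,
    C.curve_eq (q := m) (by omega) (hl ▸ hlt.le) hl.ge, hl,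
    div_self (by rw [← hl]; exact (sub_pos.2 hlt).ne'), polygonal_one, bezier_one]

theorem subdivide_curve (C : CompositeBezier) {t : ℝ} (ht : t ∈ Set.Icc (0 : ℝ) 1) :
    C.subdivide.curve t = C.curve t := by
  obtain ⟨q, hq, h0, h1⟩ := C.subdivide.exists_segment ht
  have hq' : q / 2 < C.numSeg := by
    have : q < 2 * C.numSeg := hq
    omega
  have hlt := C.knot_lt (q / 2) hq'
  rw [C.subdivide.curve_eq hq h0 h1]
  rcases Nat.mod_two_eq_zero_or_one q with hm | hm
  · have e1 : (q + 1) % 2 = 1 := by omega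
    have e2 : (q + 1) / 2 = q / 2 := by omega
    simp only [subdivide, hm, e1, e2, if_true, one_ne_zero, if_false] at h0 h1 ⊢
    rw [C.curve_eq hq' h0 (by linarith), bezier_leftPolygon]
    congr 1
    have : C.knot (q / 2 + 1) - C.knot (q / 2) ≠ 0 := (sub_pos.2 hlt).ne'
    rw [show (C.knot (q / 2) + C.knot (q / 2 + 1)) / 2 - C.knot (q / 2) =
      (C.knot (q / 2 + 1) - C.knot (q / 2)) / 2 by ring]
    field_simp
  · have e1 : (q + 1) % 2 = 0 := by omega
    have e2 : (q + 1) / 2 = q / 2 + 1 := by omega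
    simp only [subdivide, hm, e1, e2, if_true, one_ne_zero, if_false] at h0 h1 ⊢
    rw [C.curve_eq hq' (by linarith) h1, bezier_rightPolygon]
    congr 1
    have : C.knot (q / 2 + 1) - C.knot (q / 2) ≠ 0 := (sub_pos.2 hlt).ne'
    rw [show C.knot (q / 2 + 1) - (C.knot (q / 2) + C.knot (q / 2 + 1)) / 2 =
      (C.knot (q / 2 + 1) - C.knot (q / 2)) / 2 by ring]
    field_simp
    ring

theorem subdivide_iterate_curve (C : CompositeBezier) (i : ℕ) {t : ℝ}
    (ht : t ∈ Set.Icc (0 : ℝ) 1) : (subdivide^[i] C).curve t = C.curve t := by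
  induction i with
  | zero => rfl
  | succ i ih => rw [Function.iterate_succ_apply', subdivide_curve _ ht, ih]

/-- A bound on the second differences of the control points, relative to the lengths of the
parameter intervals. -/
def SecondDiffBound (C : CompositeBezier) (K : ℝ) : Prop :=
  ∀ q < C.numSeg, ∀ j, j + 2 ≤ C.deg q →
    (C.deg q : ℝ) ^ 2 * ‖secondDiff (C.ctrl q) j‖ ≤ K * (C.knot (q + 1) - C.knot q)

theorem exists_secondDiffBound (C : CompositeBezier) : ∃ K, 0 ≤ K ∧ C.SecondDiffBound K := by
  -- The absolute value keeps `F` nonnegative beyond `numSeg`, where knots are arbitrary.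
  set F : ℕ → ℕ → ℝ := fun q j =>
    (C.deg q : ℝ) ^ 2 * ‖secondDiff (C.ctrl q) j‖ / |C.knot (q + 1) - C.knot q| with hF
  have hF0 : ∀ q j, 0 ≤ F q j := fun q j => by positivity
  refine ⟨∑ q ∈ Finset.range C.numSeg, ∑ j ∈ Finset.range (C.deg q), F q j,
    Finset.sum_nonneg fun q _ => Finset.sum_nonneg fun j _ => hF0 q j, fun q hq j hj => ?_⟩
  have hlt := sub_pos.2 (C.knot_lt q hq)
  rw [← div_le_iff₀ hlt]
  calc _ = F q j := by rw [hF]; simp only [abs_of_pos hlt]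
    _ ≤ ∑ j ∈ Finset.range (C.deg q), F q j :=
      Finset.single_le_sum (f := F q) (fun j _ => hF0 q j) (Finset.mem_range.2 (by omega))
    _ ≤ _ := Finset.single_le_sum (f := fun q => ∑ j ∈ Finset.range (C.deg q), F q j)
      (fun q _ => Finset.sum_nonneg fun j _ => hF0 q j) (Finset.mem_range.2 hq)

/-- A factor 1/4 from the second differences against 1/2 from the interval lengths. -/
theorem SecondDiffBound.subdivide {C : CompositeBezier} {K : ℝ} (h : C.SecondDiffBound K) :
    C.subdivide.SecondDiffBound (K / 2) := by
  intro q hq j hj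
  have hq' : q / 2 < C.numSeg := by
    have : q < 2 * C.numSeg := hq
    omega
  change j + 2 ≤ C.deg (q / 2) at hj
  change (C.deg (q / 2) : ℝ) ^ 2 * _ ≤ _
  have hn : (0 : ℝ) < (C.deg (q / 2) : ℝ) ^ 2 := by
    have : 0 < C.deg (q / 2) := by omega
    positivity
  set M := K * (C.knot (q / 2 + 1) - C.knot (q / 2)) / (C.deg (q / 2) : ℝ) ^ 2 with hM
  have hb : ∀ j, j + 2 ≤ C.deg (q / 2) → ‖secondDiff (C.ctrl (q / 2)) j‖ ≤ M := by
    intro j hj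
    rw [hM, le_div_iff₀' hn]
    exact h _ hq' j hj
  have hMn : (C.deg (q / 2) : ℝ) ^ 2 * M = K * (C.knot (q / 2 + 1) - C.knot (q / 2)) := by
    rw [hM, mul_div_cancel₀ _ hn.ne']
  have hknot : C.subdivide.knot (q + 1) - C.subdivide.knot q =
      (C.knot (q / 2 + 1) - C.knot (q / 2)) / 2 := by
    rcases Nat.mod_two_eq_zero_or_one q with hm | hm
    · have e1 : (q + 1) % 2 = 1 := by omega
      have e2 : (q + 1) / 2 = q / 2 := by omega
      simp only [CompositeBezier.subdivide, hm, e1, e2, if_true, one_ne_zero, if_false]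
      ring
    · have e1 : (q + 1) % 2 = 0 := by omega
      have e2 : (q + 1) / 2 = q / 2 + 1 := by omega
      simp only [CompositeBezier.subdivide, hm, e1, e2, if_true, one_ne_zero, if_false]
      ring
  have hsd : ‖secondDiff (C.subdivide.ctrl q) j‖ ≤ M / 4 := by
    rcases Nat.mod_two_eq_zero_or_one q with hm | hm
    · have := norm_secondDiff_deCasteljau_le hb j 0 (by omega)
      simp only [CompositeBezier.subdivide, hm, if_true]
      rw [secondDiff_leftPolygon, norm_smul]
      norm_num
      linarith
    · have := norm_secondDiff_deCasteljau_le hb (C.deg (q / 2) - j - 2) j (by omega)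
      simp only [CompositeBezier.subdivide, hm, one_ne_zero, if_false]
      rw [secondDiff_rightPolygon _ hj, norm_smul]
      norm_num
      linarith
  rw [hknot]
  have := mul_le_mul_of_nonneg_left hsd hn.le
  linarith

theorem SecondDiffBound.iterate {C : CompositeBezier} {K : ℝ} (h : C.SecondDiffBound K) (i : ℕ) :
    (CompositeBezier.subdivide^[i] C).SecondDiffBound (K / 2 ^ i) := by
  induction i with
  | zero => simpa using h
  | succ i ih =>
    rw [Function.iterate_succ_apply', pow_succ, ← div_div]
    exact ih.subdivide

/-- Passing to the local parameter divides by the interval length, which the definition of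
`SecondDiffBound` compensates. -/
theorem SecondDiffBound.norm_le {C : CompositeBezier} {K : ℝ} (hK : 0 ≤ K)
    (h : C.SecondDiffBound K) {s t : ℝ} (hs : 0 ≤ s) (hst : s < t) (ht : t ≤ 1) :
    ‖(C.controlPolygon t - C.curve t) - (C.controlPolygon s - C.curve s)‖ ≤ K * (t - s) := by
  refine lipschitz_of_partition (f := fun t => C.controlPolygon t - C.curve t) (x := C.knot)
    (m := C.numSeg) ?_ (fun j hj => (C.knot_lt j hj).le) s t (C.knot_zero.symm ▸ hs) hst.le
    (C.knot_last.symm ▸ ht) hst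
  intro q hq s t hs hst ht
  rcases hst.eq_or_lt with rfl | hst'
  · simp
  have hlt := sub_pos.2 (C.knot_lt q hq)
  set l := C.knot (q + 1) - C.knot q with hl
  simp only [C.controlPolygon_eq hq hs (hst.trans ht), C.controlPolygon_eq hq (hs.trans hst) ht,
    C.curve_eq hq hs (hst.trans ht), C.curve_eq hq (hs.trans hst) ht, ← hl]
  have hb : ∀ j, j + 2 ≤ C.deg q →
      ‖secondDiff (C.ctrl q) j‖ ≤ K * l / (C.deg q : ℝ) ^ 2 := by
    intro j hj
    have : 0 < C.deg q := by omega
    rw [le_div_iff₀' (by positivity)]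
    exact h q hq j hj
  refine (norm_polygonal_sub_bezier_le (by positivity) hb (div_nonneg (by linarith) hlt.le)
    (by gcongr) ((div_le_one hlt).2 (by linarith))).trans ?_
  have e : (t - C.knot q) / l - (s - C.knot q) / l = (t - s) / l := by ring
  rw [e]
  have h1 : (C.deg q : ℝ) ^ 2 * (K * l / (C.deg q : ℝ) ^ 2) ≤ K * l := by
    rcases eq_or_ne ((C.deg q : ℝ) ^ 2) 0 with h0 | h0
    · rw [h0]; simp; positivity
    · rw [mul_div_cancel₀ _ h0]
  calc _ ≤ K * l * ((t - s) / l) :=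
        mul_le_mul_of_nonneg_right h1 (div_nonneg (by linarith) hlt.le)
    _ = K * (t - s) := by field_simp

end CompositeBezier

/-! ### Chord bounds for simple regular curves -/

/-- A quantitative form of simplicity: chords are bounded below by a multiple of the parameter
distance, measured on a circle if the curve is closed. -/
def ChordBound (γ : ℝ → R3) (c : ℝ) (s t : ℝ) : Prop :=
  c * (t - s) ≤ ‖γ t - γ s‖ ∨ γ 0 = γ 1 ∧ c * (s + (1 - t)) ≤ ‖γ t - γ s‖

theorem ChordBound.mono {γ : ℝ → R3} {c c' s t : ℝ} (h : ChordBound γ c s t) (hc : c' ≤ c)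
    (hs : 0 ≤ s) (hst : s ≤ t) (ht : t ≤ 1) : ChordBound γ c' s t :=
  h.imp (fun h => (mul_le_mul_of_nonneg_right hc (by linarith)).trans h)
    (fun h => ⟨h.1, (mul_le_mul_of_nonneg_right hc (by linarith)).trans h.2⟩)

/-- Near each parameter, a `C¹` curve differs from its tangent line by a function of small
Lipschitz constant. -/
theorem exists_norm_sub_sub_smul_le {γ : ℝ → R3} (hγ : ContDiffOn ℝ 1 γ (Set.Icc 0 1)) {a : ℝ}
    (ha : a ∈ Set.Icc (0 : ℝ) 1) {ε : ℝ} (hε : 0 < ε) :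
    ∃ δ > 0, ∀ s ∈ Set.Icc (0 : ℝ) 1, ∀ t ∈ Set.Icc (0 : ℝ) 1, |s - a| < δ → |t - a| < δ →
      ‖γ t - γ s - (t - s) • derivWithin γ (Set.Icc 0 1) a‖ ≤ ε * |t - s| := by
  have hcont := hγ.continuousOn_derivWithin (uniqueDiffOn_Icc one_pos) le_rfl
  obtain ⟨δ, hδ, h⟩ := Metric.continuousOn_iff.1 hcont a ha ε hε
  refine ⟨δ, hδ, fun s hs t ht hsa hta => ?_⟩
  set v := derivWithin γ (Set.Icc 0 1) a
  have hd : ∀ u ∈ Set.Icc (0 : ℝ) 1 ∩ Metric.ball a δ, HasDerivWithinAt (fun u => γ u - u • v)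
      (derivWithin γ (Set.Icc 0 1) u - v) (Set.Icc (0 : ℝ) 1 ∩ Metric.ball a δ) u := by
    intro u hu
    have h1 := ((hγ.differentiableOn one_ne_zero) u hu.1).hasDerivWithinAt
    have h2 := ((hasDerivAt_id u).smul_const v).hasDerivWithinAt (s := Set.Icc (0 : ℝ) 1)
    rw [one_smul] at h2
    exact (h1.sub h2).mono Set.inter_subset_left
  have hb : ∀ u ∈ Set.Icc (0 : ℝ) 1 ∩ Metric.ball a δ,
      ‖derivWithin γ (Set.Icc 0 1) u - v‖ ≤ ε := by
    intro u hu
    rw [← dist_eq_norm]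
    exact (h u hu.1 hu.2).le
  have := ((convex_Icc (0 : ℝ) 1).inter
    (convex_ball a δ)).norm_image_sub_le_of_norm_hasDerivWithin_le hd hb
    ⟨hs, by simpa [Real.dist_eq] using hsa⟩ ⟨ht, by simpa [Real.dist_eq] using hta⟩
  rw [Real.norm_eq_abs] at this
  refine (le_of_eq (congrArg norm ?_)).trans this
  module

/-- Two nonzero vectors that are not opposite in direction have no short nonnegative linear
combinations. -/
theorem exists_le_norm_smul_add_smul {v w : R3} (hv : v ≠ 0) (hw : w ≠ 0)
    (h : ∀ c : ℝ, 0 < c → v ≠ -(c • w)) :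
    ∃ c > 0, ∀ x y : ℝ, 0 ≤ x → 0 ≤ y → c * (x + y) ≤ ‖x • v + y • w‖ := by
  -- By homogeneity it suffices to minimize over x + y = 1; a zero minimum would make `v` and `w`
  -- opposite or one of them zero.
  obtain ⟨z, hz, hmin⟩ := isCompact_Icc.exists_isMinOn (Set.nonempty_Icc.2 zero_le_one)
    (f := fun z : ℝ => ‖z • v + (1 - z) • w‖) (by fun_prop)
  refine ⟨‖z • v + (1 - z) • w‖, norm_pos_iff.2 fun h0 => ?_, fun x y hx hy => ?_⟩
  · rcases hz.1.eq_or_lt with h1 | h1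
    · rw [← h1] at h0; simp [hw] at h0
    · rcases hz.2.eq_or_lt with h2 | h2
      · rw [h2] at h0; simp [hv] at h0
      · refine h ((1 - z) / z) (div_pos (by linarith) h1) ?_
        rw [div_eq_inv_mul, ← smul_smul, ← smul_neg, eq_inv_smul_iff₀ h1.ne']
        exact eq_neg_of_add_eq_zero_left h0
  · rcases (add_nonneg hx hy).eq_or_lt with h1 | h1
    · rw [← h1, mul_zero]; exact norm_nonneg _
    · have h2 : x / (x + y) ∈ Set.Icc (0 : ℝ) 1 :=
        ⟨by positivity, (div_le_one h1).2 (by linarith)⟩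
      have h3 := isMinOn_iff.1 hmin _ h2
      have h4 : x • v + y • w = (x + y) • ((x / (x + y)) • v + (1 - x / (x + y)) • w) := by
        rw [smul_add, smul_smul, smul_smul, mul_sub, mul_div_cancel₀ _ h1.ne']
        ring_nf
      rw [h4, norm_smul, Real.norm_of_nonneg h1.le, mul_comm]
      exact mul_le_mul_of_nonneg_left h3 h1.le

theorem exists_chordBound_near_diag {γ : ℝ → R3} (hγ : ContDiffOn ℝ 1 γ (Set.Icc 0 1)) {a : ℝ}
    (ha : a ∈ Set.Icc (0 : ℝ) 1) (hv : derivWithin γ (Set.Icc 0 1) a ≠ 0) :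
    ∃ c > 0, ∃ δ > 0, ∀ s t, 0 ≤ s → s ≤ t → t ≤ 1 → |s - a| < δ → |t - a| < δ →
      ChordBound γ c s t := by
  set v := derivWithin γ (Set.Icc 0 1) a with hvdef
  have hv' := norm_pos_iff.2 hv
  obtain ⟨δ, hδ, h⟩ := exists_norm_sub_sub_smul_le hγ ha (half_pos hv')
  refine ⟨‖v‖ / 2, half_pos hv', δ, hδ, fun s t hs hst ht hsa hta => Or.inl ?_⟩
  have h1 := h s ⟨hs, hst.trans ht⟩ t ⟨hs.trans hst, ht⟩ hsa hta
  have h2 := norm_sub_norm_le ((t - s) • v) ((t - s) • v - (γ t - γ s))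
  rw [norm_sub_rev _ (γ t - γ s), sub_sub_cancel, norm_smul,
    Real.norm_of_nonneg (by linarith)] at h2
  rw [abs_of_nonneg (by linarith), ← hvdef] at h1
  linarith

/-- Through the closing point the chord is s • v + (1 - t) • w up to an error of half its lower
bound; without a cusp the two terms cannot cancel. -/
theorem exists_chordBound_near_closing {γ : ℝ → R3} (hγ : ContDiffOn ℝ 1 γ (Set.Icc 0 1))
    (hreg : ∀ t ∈ Set.Icc (0 : ℝ) 1, derivWithin γ (Set.Icc 0 1) t ≠ 0)
    (hcusp : ¬ HasClosingCusp γ) (hclosed : γ 0 = γ 1) :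
    ∃ c > 0, ∃ δ > 0, ∀ s t, 0 ≤ s → s ≤ t → t ≤ 1 → |s - 0| < δ → |t - 1| < δ →
      ChordBound γ c s t := by
  have m0 : (0 : ℝ) ∈ Set.Icc (0 : ℝ) 1 := ⟨le_rfl, zero_le_one⟩
  have m1 : (1 : ℝ) ∈ Set.Icc (0 : ℝ) 1 := ⟨zero_le_one, le_rfl⟩
  set v := derivWithin γ (Set.Icc 0 1) 0 with hv
  set w := derivWithin γ (Set.Icc 0 1) 1 with hw
  obtain ⟨c, hc, hcomb⟩ := exists_le_norm_smul_add_smul (hreg 0 m0) (hreg 1 m1)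
    (fun c hc h => hcusp ⟨hclosed, c, hc, h⟩)
  obtain ⟨δ₀, hδ₀, h0⟩ := exists_norm_sub_sub_smul_le hγ m0 (half_pos hc)
  obtain ⟨δ₁, hδ₁, h1⟩ := exists_norm_sub_sub_smul_le hγ m1 (half_pos hc)
  refine ⟨c / 2, half_pos hc, min δ₀ δ₁, lt_min hδ₀ hδ₁,
    fun s t hs hst ht hs0 ht1 => Or.inr ⟨hclosed, ?_⟩⟩
  have e0 := h0 0 m0 s ⟨hs, hst.trans ht⟩ (by simpa using hδ₀) (hs0.trans_le (min_le_left _ _))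
  have e1 := h1 t ⟨hs.trans hst, ht⟩ 1 m1 (ht1.trans_le (min_le_right _ _)) (by simpa using hδ₁)
  rw [abs_of_nonneg (by linarith), ← hv, sub_zero] at e0
  rw [abs_of_nonneg (by linarith), ← hw] at e1
  have e2 := hcomb s (1 - t) hs (by linarith)
  have e3 : s • v + (1 - t) • w =
      (γ s - γ t) - ((γ s - γ 0 - s • v) + (γ 1 - γ t - (1 - t) • w)) := by
    rw [hclosed]; abel
  have e4 := norm_sub_le (γ s - γ t) ((γ s - γ 0 - s • v) + (γ 1 - γ t - (1 - t) • w))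
  have e5 := norm_add_le (γ s - γ 0 - s • v) (γ 1 - γ t - (1 - t) • w)
  rw [e3] at e2
  rw [norm_sub_rev (γ t)]
  linarith

theorem exists_chordBound_near_off_diag {γ : ℝ → R3} (hγ : ContinuousOn γ (Set.Icc 0 1))
    {a b : ℝ} (ha : a ∈ Set.Icc (0 : ℝ) 1) (hb : b ∈ Set.Icc (0 : ℝ) 1) (hab : γ a ≠ γ b) :
    ∃ c > 0, ∃ δ > 0, ∀ s t, 0 ≤ s → s ≤ t → t ≤ 1 → |s - a| < δ → |t - b| < δ →
      ChordBound γ c s t := by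
  have hc : 0 < ‖γ b - γ a‖ := norm_pos_iff.2 (sub_ne_zero.2 hab.symm)
  set c := ‖γ b - γ a‖ with hcdef
  obtain ⟨δ₀, hδ₀, h0⟩ := Metric.continuousOn_iff.1 hγ a ha (c / 4) (by positivity)
  obtain ⟨δ₁, hδ₁, h1⟩ := Metric.continuousOn_iff.1 hγ b hb (c / 4) (by positivity)
  refine ⟨c / 2, half_pos hc, min δ₀ δ₁, lt_min hδ₀ hδ₁,
    fun s t hs hst ht hsa htb => Or.inl ?_⟩
  have e0 := h0 s ⟨hs, hst.trans ht⟩ (hsa.trans_le (min_le_left _ _))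
  have e1 := h1 t ⟨hs.trans hst, ht⟩ (htb.trans_le (min_le_right _ _))
  rw [dist_eq_norm] at e0 e1
  have e2 : γ b - γ a = (γ t - γ s) - ((γ t - γ b) - (γ s - γ a)) := by abel
  have e3 := norm_sub_le (γ t - γ s) ((γ t - γ b) - (γ s - γ a))
  have e4 := norm_sub_le (γ t - γ b) (γ s - γ a)
  rw [← e2, ← hcdef] at e3
  have e5 : c / 2 * (t - s) ≤ c / 2 * 1 := mul_le_mul_of_nonneg_left (by linarith) (by linarith)
  linarith

/-- Local bounds near each point of the compact triangle s ≤ t: regularity serves the diagonal, the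
cusp condition the corner (0, 1) of a closed curve, simplicity the rest. -/
theorem exists_chordBound {γ : ℝ → R3} (hγ : ContDiffOn ℝ 1 γ (Set.Icc 0 1))
    (hreg : IsRegularCurve γ) (hsimple : IsSimpleCurve γ) (hcusp : ¬ HasClosingCusp γ) :
    ∃ c > 0, ∀ s t, 0 ≤ s → s ≤ t → t ≤ 1 → ChordBound γ c s t := by
  have key : ∃ c > 0, ∀ x ∈ Set.Icc (0 : ℝ) 1 ×ˢ Set.Icc (0 : ℝ) 1, x.1 ≤ x.2 →
      ChordBound γ c x.1 x.2 := by
    have hcomp : IsCompact {x ∈ Set.Icc (0 : ℝ) 1 ×ˢ Set.Icc (0 : ℝ) 1 | x.1 ≤ x.2} :=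
      (isCompact_Icc.prod isCompact_Icc).inter_right (isClosed_le continuous_fst continuous_snd)
    have := hcomp.induction_on (p := fun S => ∃ c > 0, ∀ x ∈ S,
      x ∈ Set.Icc (0 : ℝ) 1 ×ˢ Set.Icc (0 : ℝ) 1 → x.1 ≤ x.2 → ChordBound γ c x.1 x.2)
      ⟨1, one_pos, by simp⟩
      (fun S T hST ⟨c, hc, h⟩ => ⟨c, hc, fun x hx => h x (hST hx)⟩)
      (fun S T ⟨c, hc, h⟩ ⟨d, hd, h'⟩ => ⟨min c d, lt_min hc hd, fun x hx hx1 hx2 => by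
        rcases hx with hx | hx
        · exact (h x hx hx1 hx2).mono (min_le_left _ _) hx1.1.1 hx2 hx1.2.2
        · exact (h' x hx hx1 hx2).mono (min_le_right _ _) hx1.1.1 hx2 hx1.2.2⟩)
      (fun ⟨a, b⟩ ⟨⟨ha, hb⟩, hab⟩ => by
        have hloc : ∃ c > 0, ∃ δ > 0, ∀ s t, 0 ≤ s → s ≤ t → t ≤ 1 → |s - a| < δ →
            |t - b| < δ → ChordBound γ c s t := by
          rcases (show a ≤ b from hab).eq_or_lt with rfl | hlt
          · exact exists_chordBound_near_diag hγ ha (hreg.2 a ha)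
          · by_cases he : γ a = γ b
            · obtain ⟨rfl, rfl⟩ := hsimple a ha b hb hlt he
              exact exists_chordBound_near_closing hγ hreg.2 hcusp he
            · exact exists_chordBound_near_off_diag hγ.continuousOn ha hb he
        obtain ⟨c, hc, δ, hδ, h⟩ := hloc
        refine ⟨Metric.ball a δ ×ˢ Metric.ball b δ, mem_nhdsWithin_of_mem_nhds
          (prod_mem_nhds (Metric.ball_mem_nhds a hδ) (Metric.ball_mem_nhds b hδ)), c, hc, ?_⟩
        rintro ⟨s, t⟩ ⟨hs, ht⟩ ⟨hs', ht'⟩ hst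
        exact h s t hs'.1 hst ht'.2 hs ht)
    obtain ⟨c, hc, h⟩ := this
    exact ⟨c, hc, fun x hx hx' => h x ⟨hx, hx'⟩ hx hx'⟩
  obtain ⟨c, hc, h⟩ := key
  exact ⟨c, hc, fun s t hs hst ht => h (s, t) ⟨⟨hs, hst.trans ht⟩, hs.trans hst, ht⟩ hst⟩

/-! ### Double points of the perturbed curve and the homeomorphism -/

/-- A perturbation of small Lipschitz constant that fixes the end points creates no new double
points. -/
theorem eq_of_chordBound {γ g : ℝ → R3} {c K : ℝ}
    (hγ : ∀ s t, 0 ≤ s → s ≤ t → t ≤ 1 → ChordBound γ c s t) (hKc : K < c)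
    (hg : ∀ s t, 0 ≤ s → s < t → t ≤ 1 → ‖(g t - γ t) - (g s - γ s)‖ ≤ K * (t - s))
    (h0 : g 0 = γ 0) (h1 : g 1 = γ 1) {s t : ℝ} (hs : 0 ≤ s) (hst : s < t) (ht : t ≤ 1)
    (he : g s = g t) : γ 0 = γ 1 ∧ s = 0 ∧ t = 1 := by
  have e0 : ‖γ t - γ s‖ = ‖(g t - γ t) - (g s - γ s)‖ := by
    rw [he, sub_sub_sub_cancel_left, norm_sub_rev]
  rcases hγ s t hs hst.le ht with h | ⟨hc, h⟩
  · have h2 := hg s t hs hst ht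
    have := mul_lt_mul_of_pos_right hKc (sub_pos.2 hst)
    linarith
  · refine ⟨hc, ?_⟩
    -- The perturbation vanishes at both ends, so it too is controlled by the distance around the
    -- circle.
    have hs0 : ‖g s - γ s‖ ≤ K * s := by
      rcases hs.eq_or_lt with rfl | hs'
      · simp [h0]
      · simpa [h0] using hg 0 s le_rfl hs' (by linarith)
    have ht1 : ‖g t - γ t‖ ≤ K * (1 - t) := by
      rcases ht.eq_or_lt with rfl | ht'
      · simp [h1]
      · simpa [h1, norm_sub_rev] using hg t 1 (by linarith) ht' le_rfl
    have h2 := norm_sub_le (g t - γ t) (g s - γ s)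
    have h3 : 0 ≤ (c - K) * -(s + (1 - t)) := by linarith
    have h4 := nonneg_of_mul_nonneg_right h3 (sub_pos.2 hKc)
    constructor <;> linarith

/-- Continuous images of a compact set under maps with the same double points are homeomorphic. -/
theorem nonempty_homeomorph_image {X Y Z : Type*} [TopologicalSpace X] [TopologicalSpace Y]
    [TopologicalSpace Z] [T2Space Y] [T2Space Z] {S : Set X} (hS : IsCompact S) {f : X → Y}
    {g : X → Z} (hf : ContinuousOn f S) (hg : ContinuousOn g S)
    (h : ∀ x ∈ S, ∀ y ∈ S, f x = f y ↔ g x = g y) : Nonempty ((f '' S) ≃ₜ (g '' S)) := by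
  have := isCompact_iff_compactSpace.1 hS
  have hf' := continuousOn_iff_continuous_domRestrict.1 hf
  have hg' := continuousOn_iff_continuous_domRestrict.1 hg
  -- Equal kernels give homeomorphic quotients; a continuous map from a compact to a Hausdorff space
  -- is closed, so each quotient is the range.
  have e : Quotient (Setoid.ker (S.domRestrict f)) ≃ₜ Quotient (Setoid.ker (S.domRestrict g)) :=
    Homeomorph.Quotient.congrRight fun x y => h x x.2 y y.2
  rw [← Set.range_domRestrict f S, ← Set.range_domRestrict g S]
  exact ⟨(Homeomorph.quotientKerEquivRange (hf'.isClosedMap.isStrictMap hf')).symm.trans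
    (e.trans (Homeomorph.quotientKerEquivRange (hg'.isClosedMap.isStrictMap hg')))⟩

theorem continuousOn_of_norm_sub_le {f : ℝ → R3} {K : ℝ} (hK : 0 ≤ K)
    (hf : ∀ s t, 0 ≤ s → s < t → t ≤ 1 → ‖f t - f s‖ ≤ K * (t - s)) :
    ContinuousOn f (Set.Icc 0 1) := by
  refine (LipschitzOnWith.of_dist_le_mul (K := NNReal.mk K hK) fun s hs t ht => ?_).continuousOn
  rw [dist_eq_norm, Real.dist_eq, NNReal.coe_mk]
  rcases lt_trichotomy s t with h | rfl | h
  · rw [norm_sub_rev, abs_sub_comm, abs_of_pos (sub_pos.2 h)]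
    exact hf s t hs.1 h ht.2
  · simp
  · rw [abs_of_pos (sub_pos.2 h)]
    exact hf t s ht.1 h hs.2

theorem mainTheorem2 (C : CompositeBezier)
    (hC1 : ContDiffOn ℝ 1 C.curve (Set.Icc 0 1))
    (hregular : IsRegularCurve C.curve)
    (hsimple : IsSimpleCurve C.curve)
    (hcusp : ¬ HasClosingCusp C.curve) :
    ∃ N : ℕ, ∀ i : ℕ, N ≤ i →
      IsSimpleCurve (CompositeBezier.subdivide^[i] C).controlPolygon ∧
        Nonempty (((CompositeBezier.subdivide^[i] C).controlPolygon '' Set.Icc (0 : ℝ) 1) ≃ₜ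
          (C.curve '' Set.Icc (0 : ℝ) 1)) := by
  obtain ⟨c, hc, hchord⟩ := exists_chordBound hC1 hregular hsimple hcusp
  obtain ⟨K, hK, hbound⟩ := C.exists_secondDiffBound
  have hlim : Filter.Tendsto (fun i : ℕ => K / 2 ^ i) Filter.atTop (nhds 0) :=
    tendsto_const_nhds.div_atTop (tendsto_pow_atTop_atTop_of_one_lt one_lt_two)
  obtain ⟨N, hN⟩ := Filter.eventually_atTop.1 (hlim.eventually_lt_const hc)
  refine ⟨N, fun i hi => ?_⟩
  have m0 : (0 : ℝ) ∈ Set.Icc (0 : ℝ) 1 := ⟨le_rfl, zero_le_one⟩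
  have m1 : (1 : ℝ) ∈ Set.Icc (0 : ℝ) 1 := ⟨zero_le_one, le_rfl⟩
  set D := CompositeBezier.subdivide^[i] C
  -- Subdivision does not move the curve, so one `c` serves all `i`.
  have hDC : ∀ t ∈ Set.Icc (0 : ℝ) 1, D.curve t = C.curve t :=
    fun t ht => C.subdivide_iterate_curve i ht
  have hKi : 0 ≤ K / 2 ^ i := by positivity
  have hlip : ∀ s t, 0 ≤ s → s < t → t ≤ 1 →
      ‖(D.controlPolygon t - C.curve t) - (D.controlPolygon s - C.curve s)‖ ≤
        K / 2 ^ i * (t - s) := by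
    intro s t hs hst ht
    rw [← hDC s ⟨hs, hst.le.trans ht⟩, ← hDC t ⟨hs.trans hst.le, ht⟩]
    exact (hbound.iterate i).norm_le hKi hs hst ht
  have h0 : D.controlPolygon 0 = C.curve 0 := by rw [D.controlPolygon_zero, hDC 0 m0]
  have h1 : D.controlPolygon 1 = C.curve 1 := by rw [D.controlPolygon_one, hDC 1 m1]
  have hdouble : ∀ s t, 0 ≤ s → s < t → t ≤ 1 → D.controlPolygon s = D.controlPolygon t →
      C.curve 0 = C.curve 1 ∧ s = 0 ∧ t = 1 :=
    fun s t hs hst ht he => eq_of_chordBound hchord (hN i hi) hlip h0 h1 hs hst ht he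
  refine ⟨fun s hs t ht hst he => (hdouble s t hs.1 hst ht.2 he).2, ?_⟩
  have hcont : ContinuousOn D.controlPolygon (Set.Icc 0 1) := by
    have := (continuousOn_of_norm_sub_le
      (f := fun t => D.controlPolygon t - C.curve t) hKi hlip).add hC1.continuousOn
    exact this.congr fun t _ => (sub_add_cancel _ _).symm
  have hiff : ∀ s ∈ Set.Icc (0 : ℝ) 1, ∀ t ∈ Set.Icc (0 : ℝ) 1, s < t →
      (D.controlPolygon s = D.controlPolygon t ↔ C.curve s = C.curve t) := by
    intro s hs t ht hst
    constructor
    · intro he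
      obtain ⟨hcl, rfl, rfl⟩ := hdouble s t hs.1 hst ht.2 he
      exact hcl
    · intro he
      obtain ⟨rfl, rfl⟩ := hsimple s hs t ht hst he
      rw [h0, h1, he]
  refine nonempty_homeomorph_image isCompact_Icc hcont hC1.continuousOn fun s hs t ht => ?_
  rcases lt_trichotomy s t with h | rfl | h
  · exact hiff s hs t ht h
  · simp
  · rw [eq_comm, hiff t ht s hs h, eq_comm]
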